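/- Let $k$ be a commutative ring. For finite sets $X,Y$ let $\mathcal C(Y,X)$ be the set of all subsets of $Y\times X$ (correspondences from $X$ to $Y$), with composition $RS=\{(z,x)\mid \exists y,\ (z,y)\in R,\ (y,x)\in S\}$; let $k\mathcal C$ be the $k$-linearization of the resulting category of finite sets and correspondences, and let $\mathcal F_k$ be the category of correspondence functors, i.e. of $k$-linear functors from $k\mathcal C$ to $k$-modules. For a finite lattice $T$ with least element $\hat 0$, let $F_T\in\mathcal F_k$ be the functor such that $F_T(X)$ is the free $k$-module on the set of all maps $X\to T$, where a correspondence $Q\in\mathcal C(Y,X)$ sends $\varphi:X\to T$ to the map $y\mapsto\bigvee_{(y,x)\in Q}\varphi(x)$ (an empty join being $\hat 0$). Let $H_T\subseteq F_T$ be the subfunctor such that $H_T(X)$ is generated by all $\varphi:X\to T$ whose image does not contain every join-irreducible element of $T$. For a finite set $E$, let $\mathcal P_E$ (the algebra of permuted orders) be the quotient of the algebra $k\mathcal C(E,E)$ by the two-sided ideal generated by all relations that factor through a set with fewer elements than $E$ and by all differences $S-\overline S$, where $S$ is a reflexive relation on $E$ and $\overline S$ its transitive closure. For an order relation $R$ on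 $E$, let $f_R=\sum_{S\supseteq R}\mu(R,S)\,S\in\mathcal P_E$, where $S$ runs through the order relations on $E$ containing $R$ and $\mu$ is the Möbius function of the set of all order relations on $E$, ordered by inclusion. Regard the left ideal $\mathcal P_Ef_R$ as a left $k\mathcal C(E,E)$-module. The fundamental functor of $(E,R)$ is $\mathbb S_{E,R}=L/J\in\mathcal F_k$, where $L(X)=k\mathcal C(X,E)\otimes_{k\mathcal C(E,E)}\mathcal P_Ef_R$ and $$J(X)=\Big\{\sum_i\varphi_i\otimes w_i\in L(X)\ \Big|\ \sum_i(\psi\varphi_i)\cdot w_i=0\ \text{ for all }\psi\in k\mathcal C(E,X)\Big\}.$$ **Theorem.** Let $n\ge 0$ be an integer, let $\underline n=\{0<1<\dots<n\}$ be the totally ordered lattice with $n+1$ elements, and let $\mathbb S_n=F_{\underline n}/H_{\underline n}$. 1. $\mathbb S_n$ is isomorphic, in $\mathcal F_k$, to the fundamental functor $\mathbb S_{[n],\mathrm{tot}}$, where $\mathrm{tot}$ is the usual total order on $[n]=\{1,\dots,n\}$. 2. For every finite set $X$, the $k$-module $\mathbb S_n(X)$ is free of rank $\displaystyle\sum_{i=0}^n(-1)^{n-i}\binom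 ni(i+1)^{|X|}$. -/

import Mathlib

open CategoryTheory TensorProduct

universe u w t e m

namespace CorrFun

/-! ### Correspondences -/

/-- The set `𝒞(Y, X)` of all correspondences from `X` to `Y`, i.e. all subsets of `Y × X`. -/
abbrev Corr (Y : Type*) (X : Type*) := Set (Y × X)

namespace Corr

/-- The composite `R S = {(z, x) | ∃ y, (z, y) ∈ R ∧ (y, x) ∈ S}`. -/
def comp {Z Y X : Type*} (R : Corr Z Y) (S : Corr Y X) : Corr Z X :=
  {p : Z × X | ∃ y : Y, (p.1, y) ∈ R ∧ (y, p.2) ∈ S}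

/-- The identity correspondence `Δ_X`. -/
def diag (X : Type*) : Corr X X := {p : X × X | p.1 = p.2}

theorem comp_assoc {A B C D : Type*} (R : Corr A B) (S : Corr B C) (T : Corr C D) :
    comp (comp R S) T = comp R (comp S T) := by
  apply Set.ext
  rintro ⟨a, d⟩
  constructor
  · rintro ⟨c, ⟨b, h1, h2⟩, h3⟩
    exact ⟨b, h1, c, h2, h3⟩
  · rintro ⟨b, h1, c, h2, h3⟩
    exact ⟨c, ⟨b, h1, h2⟩, h3⟩

theorem diag_comp {A B : Type*} (R : Corr A B) : comp (diag A) R = R := by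
  apply Set.ext
  rintro ⟨a, b⟩
  constructor
  · rintro ⟨c, h1, h2⟩
    obtain rfl : a = c := h1
    exact h2
  · intro h
    exact ⟨a, rfl, h⟩

theorem comp_diag {A B : Type*} (R : Corr A B) : comp R (diag B) = R := by
  apply Set.ext
  rintro ⟨a, b⟩
  constructor
  · rintro ⟨c, h1, h2⟩
    obtain rfl : c = b := h2
    exact h1
  · intro h
    exact ⟨b, h, rfl⟩

/-- The monoid `𝒞(E, E)` of all relations on `E`; its monoid algebra over `k` is `k𝒞(E, E)`. -/
instance (E : Type*) : Monoid (Corr E E) where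
  mul := comp
  one := diag E
  mul_assoc := comp_assoc
  one_mul := diag_comp
  mul_one := comp_diag

end Corr

/-- A finite set, as an object of the category `𝒞` of finite sets and correspondences. -/
structure FinCorr : Type (w + 1) where
  /-- the underlying type -/
  carrier : Type w
  [fintype : Fintype carrier]

instance : CoeSort FinCorr.{w} (Type w) := ⟨FinCorr.carrier⟩

instance (X : FinCorr.{w}) : Fintype X := X.fintype

/-- The category `𝒞`: the morphisms from `X` to `Y` are the elements of `𝒞(Y, X)`. -/
instance : Category FinCorr.{w} where
  Hom X Y := Corr Y X
  id X := Corr.diag X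
  comp f g := Corr.comp g f
  id_comp f := Corr.comp_diag f
  comp_id f := Corr.diag_comp f
  assoc f g h := (Corr.comp_assoc h g f).symm

/-- The category `ℱ_k` of correspondence functors: `k`-linear functors from the `k`-linearization
`k𝒞` of `𝒞` to `k`-modules. -/
abbrev CorrespondenceFunctor (k : Type u) [CommRing k] :=
  ObjectProperty.FullSubcategory
    (fun F : Free k FinCorr.{w} ⥤ ModuleCat.{m} k => F.Additive ∧ F.Linear k)

/-- The value `F(X)` of a correspondence functor at a finite set `X`. -/
abbrev CorrespondenceFunctor.eval {k : Type u} [CommRing k]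
    (F : CorrespondenceFunctor.{u, w, m} k) (X : FinCorr.{w}) : ModuleCat.{m} k :=
  F.obj.obj (Free.of k X)

/-- The `k`-linear extension to `k𝒞` of a functor defined on `𝒞`. -/
noncomputable def linearExtension {k : Type u} [CommRing k]
    (G : FinCorr.{w} ⥤ ModuleCat.{m} k) : CorrespondenceFunctor.{u, w, m} k where
  obj :=
    { obj := fun X => G.obj X
      map := fun {X Y} α =>
        Finsupp.linearCombination k
          (fun f : (show FinCorr.{w} from X) ⟶ (show FinCorr.{w} from Y) => G.map f) α
      map_id := fun X => by
        change Finsupp.linearCombination k _ (Finsupp.single _ (1 : k)) = _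
        rw [Finsupp.linearCombination_single, one_smul]
        exact G.map_id _
      map_comp := fun {X Y Z} α β => by
        induction α using Finsupp.induction_linear with
        | zero =>
          erw [Limits.zero_comp, map_zero, Limits.zero_comp]
        | add α₁ α₂ h₁ h₂ =>
          erw [Preadditive.add_comp, map_add, map_add, Preadditive.add_comp, h₁, h₂]
        | single f r =>
          induction β using Finsupp.induction_linear with
          | zero => erw [Limits.comp_zero, map_zero, Limits.comp_zero]
          | add β₁ β₂ h₁ h₂ =>
            erw [Preadditive.comp_add, map_add, map_add, Preadditive.comp_add, h₁, h₂]
          | single g s =>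
            erw [Free.single_comp_single, Finsupp.linearCombination_single,
              Finsupp.linearCombination_single, Finsupp.linearCombination_single]
            erw [G.map_comp, Linear.smul_comp, Linear.comp_smul, smul_smul] }
  property := by
    refine ⟨⟨?_⟩, ⟨?_⟩⟩
    · intro X Y α β
      exact map_add _ _ _
    · intro X Y α r
      exact map_smul _ _ _

/-- The quotient of a functor on `𝒞` by a subfunctor. -/
noncomputable def quotientFunctor {k : Type u} [CommRing k]
    (G : FinCorr.{w} ⥤ ModuleCat.{m} k) (N : ∀ X : FinCorr.{w}, Submodule k (G.obj X))
    (hN : ∀ (X Y : FinCorr.{w}) (f : X ⟶ Y), N X ≤ (N Y).comap (G.map f).hom) :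
    FinCorr.{w} ⥤ ModuleCat.{m} k where
  obj X := ModuleCat.of k (G.obj X ⧸ N X)
  map {X Y} f := ModuleCat.ofHom ((N X).mapQ (N Y) (G.map f).hom (hN X Y f))
  map_id X := by
    ext x
    simp
  map_comp {X Y Z} f g := by
    ext x
    simp

/-! ### The functor of a finite lattice -/

section Lattice

variable (k : Type u) [CommRing k] (T : Type t) [Lattice T] [OrderBot T]

open Classical in
/-- The map `φ ↦ Q φ`, where `(Q φ)(y)` is the join of all `φ(x)` with `(y, x) ∈ Q`. -/
noncomputable def act {Y X : FinCorr.{w}} (Q : Corr Y X) (φ : X → T) : Y → T := fun y =>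
  (Finset.univ.filter fun x : X => (y, x) ∈ Q).sup φ

theorem act_le_iff {Y X : FinCorr.{w}} (Q : Corr Y X) (φ : X → T) (y : Y) (a : T) :
    act T Q φ y ≤ a ↔ ∀ x : X, (y, x) ∈ Q → φ x ≤ a := by
  simp [act]

theorem act_diag {X : FinCorr.{w}} (φ : X → T) : act T (Corr.diag X) φ = φ := by
  funext y
  apply eq_of_forall_ge_iff
  intro a
  rw [act_le_iff]
  constructor
  · intro h
    exact h y rfl
  · intro h x hx
    obtain rfl : y = x := hx
    exact h

theorem act_comp {Z Y X : FinCorr.{w}} (R : Corr Z Y) (S : Corr Y X) (φ : X → T) :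
    act T (Corr.comp R S) φ = act T R (act T S φ) := by
  funext z
  apply eq_of_forall_ge_iff
  intro a
  simp only [act_le_iff]
  constructor
  · intro h y hy x hx
    exact h x ⟨y, hy, hx⟩
  · rintro h x ⟨y, hy, hx⟩
    exact h y hy x hx

/-- The functor `F_T` on `𝒞`: `F_T(X)` is the free module on the set of all maps `X → T`. -/
noncomputable def latticeFunctor : FinCorr.{w} ⥤ ModuleCat.{max w t u} k where
  obj X := ModuleCat.of k ((X → T) →₀ k)
  map {X Y} Q := ModuleCat.ofHom (Finsupp.lmapDomain k k (act T (show Corr Y X from Q)))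
  map_id X := by
    have h : act T (Corr.diag X) = id := funext fun φ => act_diag T φ
    change ModuleCat.ofHom (Finsupp.lmapDomain k k (act T (Corr.diag X))) = _
    rw [h, Finsupp.lmapDomain_id]
    rfl
  map_comp {X Y Z} f g := by
    have h : act T (Corr.comp (show Corr Z Y from g) (show Corr Y X from f)) =
        act T (show Corr Z Y from g) ∘ act T (show Corr Y X from f) :=
      funext fun φ => act_comp T _ _ φ
    change ModuleCat.ofHom (Finsupp.lmapDomain k k (act T (Corr.comp _ _))) = _
    rw [h, Finsupp.lmapDomain_comp]
    rfl

/-- `H_T(X)`: the submodule of `F_T(X)` generated by all `φ : X → T` whose image does not contain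
all (join-)irreducible elements of `T`. -/
noncomputable def latticeSub (X : FinCorr.{w}) : Submodule k ((latticeFunctor k T).obj X) :=
  Submodule.span k
    {v : (X → T) →₀ k | ∃ φ : X → T, ¬ {a : T | SupIrred a} ⊆ Set.range φ ∧
      v = Finsupp.single φ 1}

theorem latticeSub_le (X Y : FinCorr.{w}) (f : X ⟶ Y) :
    latticeSub k T X ≤ (latticeSub k T Y).comap ((latticeFunctor k T).map f).hom := by
  classical
  refine Submodule.span_le.2 ?_
  rintro v ⟨φ, hφ, rfl⟩
  refine Submodule.subset_span ⟨act T (show Corr Y X from f) φ, fun h => hφ ?_, ?_⟩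
  · intro a ha
    obtain ⟨y, hy⟩ := h ha
    obtain ⟨x, -, hx⟩ := SupIrred.finset_sup_eq ha hy
    exact ⟨x, hx⟩
  · exact Finsupp.mapDomain_single

/-- The correspondence functor `F_T / H_T`. -/
noncomputable def latticeQuotient : CorrespondenceFunctor.{u, w, max w t u} k :=
  linearExtension (quotientFunctor (latticeFunctor k T) (latticeSub k T) (latticeSub_le k T))

end Lattice

/-- The correspondence functor `𝕊_n = F_n / H_n` of the totally ordered lattice
`{0 < 1 < ⋯ < n}`. -/
noncomputable def totalS (k : Type u) [CommRing k] (n : ℕ) : CorrespondenceFunctor.{u, w, max w u} k :=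
  latticeQuotient k (Fin (n + 1))

/-! ### The fundamental module of a finite poset -/

/-- The order relations on a set `E`. -/
def OrderRel (E : Type e) :=
  {R : Corr E E // (∀ a, (a, a) ∈ R) ∧ (∀ a b, (a, b) ∈ R → (b, a) ∈ R → a = b) ∧
    ∀ a b c, (a, b) ∈ R → (b, c) ∈ R → (a, c) ∈ R}

namespace OrderRel

/-- The underlying relation. -/
def rel {E : Type e} (R : OrderRel E) : Corr E E := R.1

/-- Order relations are themselves ordered by inclusion. -/
instance (E : Type e) : PartialOrder (OrderRel E) := Subtype.partialOrder _

instance (E : Type e) [Finite E] : Finite (OrderRel E) := Subtype.finite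

noncomputable instance (E : Type e) [Finite E] : Fintype (OrderRel E) := Fintype.ofFinite _

open Classical in
noncomputable instance (E : Type e) [Finite E] : LocallyFiniteOrder (OrderRel E) :=
  Fintype.toLocallyFiniteOrder

/-- The order relation of a poset, `(a, b) ∈ R` if and only if `a ≤ b`. -/
def ofLE (E : Type e) [PartialOrder E] : OrderRel E :=
  ⟨{p | p.1 ≤ p.2}, fun a => le_refl a, fun _ _ h h' => le_antisymm h h',
    fun _ _ _ h h' => le_trans h h'⟩

end OrderRel

/-- A relation on `E` is inessential if it factors through a set with fewer elements than `E`. -/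
def Inessential {E : Type e} (Q : Corr E E) : Prop :=
  ∃ (Y : Type) (_ : Finite Y) (A : Corr E Y) (B : Corr Y E),
    Nat.card Y < Nat.card E ∧ Q = Corr.comp A B

/-- The transitive closure of a relation. -/
def transClosure {E : Type e} (S : Corr E E) : Corr E E :=
  {p : E × E | Relation.TransGen (fun a b => (a, b) ∈ S) p.1 p.2}

/-- The relations imposed on `k𝒞(E, E)` to obtain the algebra of permuted orders. -/
inductive PermutedRel (k : Type u) [CommRing k] (E : Type e) :
    MonoidAlgebra k (Corr E E) → MonoidAlgebra k (Corr E E) → Prop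
  | inessential (Q : Corr E E) (hQ : Inessential Q) :
      PermutedRel k E (MonoidAlgebra.of k (Corr E E) Q) 0
  | closure (S : Corr E E) (hS : ∀ a : E, (a, a) ∈ S) :
      PermutedRel k E (MonoidAlgebra.of k (Corr E E) S)
        (MonoidAlgebra.of k (Corr E E) (transClosure S))

/-- The algebra `𝒫_E` of permuted orders: the quotient of the algebra `k𝒞(E, E)` of relations on `E`
by the two-sided ideal generated by the inessential relations (which gives the essential algebra)
and by the differences `S - S̄`, where `S` is reflexive with transitive closure `S̄`. It has the
classes of the relations `Δ_σ R` as a basis, for `σ` a permutation and `R` an order, and the product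
of two orders is the transitive closure of their union if that is an order, and zero otherwise. -/
abbrev PermutedOrders (k : Type u) [CommRing k] (E : Type e) := RingQuot (PermutedRel k E)

section Fundamental

variable (k : Type u) [CommRing k] {E : Type e} [Finite E]

/-- The class in `𝒫_E` of a relation on `E`. -/
noncomputable def permutedClass (E : Type e) : Corr E E →* PermutedOrders k E :=
  ((RingQuot.mkAlgHom k (PermutedRel k E) :
    MonoidAlgebra k (Corr E E) →ₐ[k] PermutedOrders k E) :
      MonoidAlgebra k (Corr E E) →* PermutedOrders k E).comp (MonoidAlgebra.of k (Corr E E))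

open Classical in
/-- The idempotent `f_R = ∑ μ(R, S) S` of `𝒫_E`, where `S` runs through the orders on `E` containing
`R` and `μ` is the Möbius function of the set of all orders on `E`, ordered by inclusion. -/
noncomputable def fElement (R : OrderRel E) : PermutedOrders k E :=
  ∑ S : OrderRel E with R ≤ S, IncidenceAlgebra.mu k R S • permutedClass k E S.rel

/-- The fundamental module `𝒫_E f_R`, the left ideal of `𝒫_E` generated by `f_R`. -/
noncomputable abbrev fundamentalModule (R : OrderRel E) : Ideal (PermutedOrders k E) :=
  Ideal.span {fElement k R}

/-- The fundamental module `𝒫_E f_R` as a left module over `k𝒞(E, E)`, via `k𝒞(E, E) → 𝒫_E`. -/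
noncomputable def fundamentalRep (R : OrderRel E) :
    Representation k (Corr E E) (fundamentalModule k R) :=
  ((Algebra.lsmul k k (fundamentalModule k R) :
    PermutedOrders k E →ₐ[k] Module.End k (fundamentalModule k R)) :
      PermutedOrders k E →* Module.End k (fundamentalModule k R)).comp (permutedClass k E)

end Fundamental

/-! ### The functors `L_{E,W}` and `L_{E,W} / J_{E,W}` -/

section LJ

variable {k : Type u} [CommRing k] {E : Type e} {W : Type t} [AddCommGroup W] [Module k W]
  (ρ : Representation k (Corr E E) W)

/-- The relations defining the tensor product `k𝒞(X, E) ⊗ W` over `k𝒞(E, E)` as a quotient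
of the tensor product over the commutative ring `k`, namely `φ Q ⊗ v = φ ⊗ Q v`. (Over `k`, we write
the factor `W` first.) -/
noncomputable def balanced (X : Type w) : Submodule k (W ⊗[k] (Corr X E →₀ k)) :=
  Submodule.span k {z | ∃ (φ : Corr X E) (Q : Corr E E) (v : W),
    z = v ⊗ₜ[k] Finsupp.single (Corr.comp φ Q) (1 : k) - ρ Q v ⊗ₜ[k] Finsupp.single φ (1 : k)}

/-- `L_{E,W}(X) = k𝒞(X, E) ⊗ W`, the tensor product being over `k𝒞(E, E)`; the left
`k𝒞(E, E)`-module `W` is given by the action `ρ` of the monoid `𝒞(E, E)`. -/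
noncomputable abbrev LModule (X : Type w) := (W ⊗[k] (Corr X E →₀ k)) ⧸ balanced ρ X

/-- The action of `Q ∈ 𝒞(Y, X)`, which maps `φ ⊗ v` to `Q φ ⊗ v`. -/
noncomputable def LMap {X Y : Type w} (Q : Corr Y X) : LModule ρ X →ₗ[k] LModule ρ Y :=
  (balanced ρ X).mapQ (balanced ρ Y)
    (LinearMap.lTensor W (Finsupp.lmapDomain k k (fun φ : Corr X E => Corr.comp Q φ))) (by
      refine Submodule.span_le.2 ?_
      rintro z ⟨φ, P, v, rfl⟩
      refine Submodule.subset_span ⟨Corr.comp Q φ, P, v, ?_⟩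
      simp [Finsupp.mapDomain_single, Corr.comp_assoc])

theorem LMap_mk {X Y : Type w} (Q : Corr Y X) (v : W) (φ : Corr X E) (c : k) :
    LMap ρ Q (Submodule.Quotient.mk (v ⊗ₜ[k] Finsupp.single φ c)) =
      Submodule.Quotient.mk (v ⊗ₜ[k] Finsupp.single (Corr.comp Q φ) c) := by
  change Submodule.Quotient.mk (LinearMap.lTensor W
    (Finsupp.lmapDomain k k (fun φ : Corr X E => Corr.comp Q φ)) (v ⊗ₜ[k] Finsupp.single φ c)) = _
  simp [Finsupp.mapDomain_single]

theorem LModule_hom_ext {X : Type w} {M : Type*} [AddCommGroup M] [Module k M]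
    {f g : LModule ρ X →ₗ[k] M}
    (h : ∀ (v : W) (φ : Corr X E), f (Submodule.Quotient.mk (v ⊗ₜ[k] Finsupp.single φ 1)) =
      g (Submodule.Quotient.mk (v ⊗ₜ[k] Finsupp.single φ 1))) : f = g := by
  apply Submodule.linearMap_qext
  apply TensorProduct.ext
  apply LinearMap.ext
  intro v
  apply Finsupp.lhom_ext'
  intro φ
  apply LinearMap.ext_ring
  exact h v φ

theorem LMap_diag (X : Type w) : LMap ρ (Corr.diag X) = LinearMap.id :=
  LModule_hom_ext ρ fun v φ => by rw [LMap_mk, Corr.diag_comp]; rfl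

theorem LMap_comp {X Y Z : Type w} (Q : Corr Z Y) (P : Corr Y X) :
    LMap ρ (Corr.comp Q P) = LMap ρ Q ∘ₗ LMap ρ P :=
  LModule_hom_ext ρ fun v φ => by
    rw [LMap_mk, LinearMap.comp_apply, LMap_mk, LMap_mk, Corr.comp_assoc]

/-- For `ψ ∈ 𝒞(E, X)`, the map `L_{E,W}(X) → W` with `φ ⊗ v ↦ (ψ φ) · v`. -/
noncomputable def pairing {X : Type w} (ψ : Corr E X) : LModule ρ X →ₗ[k] W :=
  (balanced ρ X).liftQ
    (TensorProduct.lift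
      (Finsupp.linearCombination k (fun φ : Corr X E => ρ (Corr.comp ψ φ))).flip) (by
      refine Submodule.span_le.2 ?_
      rintro z ⟨φ, P, v, rfl⟩
      have h : ρ (Corr.comp ψ (Corr.comp φ P)) = ρ (Corr.comp ψ φ) * ρ P := by
        rw [← Corr.comp_assoc]
        exact map_mul ρ (Corr.comp ψ φ) P
      simp [h])

theorem pairing_mk {X : Type w} (ψ : Corr E X) (v : W) (φ : Corr X E) :
    pairing ρ ψ (Submodule.Quotient.mk (v ⊗ₜ[k] Finsupp.single φ 1)) =
      ρ (Corr.comp ψ φ) v := by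
  change TensorProduct.lift (Finsupp.linearCombination k
    (fun φ : Corr X E => ρ (Corr.comp ψ φ))).flip (v ⊗ₜ[k] Finsupp.single φ 1) = _
  simp

theorem pairing_comp {X Y : Type w} (ψ : Corr E Y) (Q : Corr Y X) :
    pairing ρ ψ ∘ₗ LMap ρ Q = pairing ρ (Corr.comp ψ Q) :=
  LModule_hom_ext ρ fun v φ => by
    rw [LinearMap.comp_apply, LMap_mk, pairing_mk, pairing_mk, Corr.comp_assoc]

/-- `L_{E,W}` as a functor on `𝒞`. -/
noncomputable def LFunctor : FinCorr.{w} ⥤ ModuleCat.{max w (max e t) u} k where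
  obj X := ModuleCat.of k (LModule ρ X)
  map {X Y} Q := ModuleCat.ofHom (LMap ρ (show Corr Y X from Q))
  map_id X := by
    rw [show (show Corr X X from 𝟙 X) = Corr.diag X from rfl, LMap_diag]
    rfl
  map_comp {X Y Z} f g := by
    rw [show (show Corr Z X from f ≫ g) = Corr.comp (show Corr Z Y from g) (show Corr Y X from f)
      from rfl, LMap_comp]
    rfl

/-- `J_{E,W}(X)`: all `∑ φᵢ ⊗ vᵢ` such that `∑ (α φᵢ) · vᵢ = 0` for all `α ∈ k𝒞(E, X)`. -/
noncomputable def JModule (X : Type w) : Submodule k (LModule ρ X) :=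
  ⨅ α : Corr E X →₀ k,
    LinearMap.ker (Finsupp.linearCombination k (fun ψ : Corr E X => pairing ρ ψ) α)

theorem mem_JModule {X : Type w} (z : LModule ρ X) :
    z ∈ JModule ρ X ↔ ∀ ψ : Corr E X, pairing ρ ψ z = 0 := by
  rw [JModule, Submodule.mem_iInf]
  constructor
  · intro h ψ
    have h' := h (Finsupp.single ψ 1)
    rwa [Finsupp.linearCombination_single, one_smul] at h'
  · intro h α
    rw [LinearMap.mem_ker, Finsupp.linearCombination_apply, Finsupp.sum, LinearMap.sum_apply]
    refine Finset.sum_eq_zero fun ψ _ => ?_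
    rw [LinearMap.smul_apply, h, smul_zero]

theorem JModule_le {X Y : Type w} (Q : Corr Y X) :
    JModule ρ X ≤ (JModule ρ Y).comap (LMap ρ Q) := by
  intro z hz
  rw [Submodule.mem_comap, mem_JModule]
  intro ψ
  rw [← LinearMap.comp_apply, pairing_comp]
  exact (mem_JModule ρ z).1 hz _

/-- The correspondence functor `L_{E,W} / J_{E,W}`. -/
noncomputable def LJQuotient : CorrespondenceFunctor.{u, w, max w (max e t) u} k :=
  linearExtension (quotientFunctor (LFunctor ρ) (fun X => JModule ρ X)
    (fun _ _ f => JModule_le ρ f))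

end LJ

/-- The fundamental functor `𝕊_{E,R}` of a finite poset `(E, R)`. -/
noncomputable def fundamentalFunctor (k : Type u) [CommRing k] {E : Type e} [Finite E]
    (R : OrderRel E) : CorrespondenceFunctor.{u, w, max w e u} k :=
  LJQuotient (W := fundamentalModule k R) (fundamentalRep k R)

/-- The total order on `[n] = {1, …, n}`. -/
def totalOrder (n : ℕ) : OrderRel (Set.Icc 1 n) := OrderRel.ofLE (Set.Icc 1 n)

end CorrFun

namespace CorrFun

/-! ### Maps to a totally ordered lattice -/

/-! Let `T` be the chain `{0 < ⋯ < n}`, `E = [n]` with its total order `R`, and let `γ : E → T`, `e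
↦ n + 1 - e`, be the order-reversing bijection onto the nonzero elements. Both functors are
quotients of `k𝒞(-, E)`: one by `φ ↦ [φγ]`, the other by `φ ↦ [φ ⊗ f_R]`. The isomorphism amounts to
equality of the two kernels.

A total order is maximal among orders, so `f_R` is the class of `R`. Hence `∑ z_φ φ` dies in `L/J`
exactly when `∑ z_φ [ψφR] = 0` in `𝒫_E` for every `ψ` (`toLJ_fundamentalGen_eq_zero_iff`). Moreover
`φR = {(x, e) | γ(e) ≤ (φγ)(x)}` depends only on `α = φγ` (`comp_ofLE`).

If `α` misses a nonzero value, this level correspondence factors through `E` minus a point, so its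
composites with all `ψ` vanish in `𝒫_E`. Conversely, `𝒫_E` acts on `F_T(E)/H_T(E)`; the coefficient
of `γ` in the image of `γ` is a linear form on `𝒫_E` with value 1 or 0 on `[Q]` according to whether
`Qγ = γ` (`exists_functional`). It turns the vanishing conditions into sums over the `α` with `ψα =
γ`, and suitable combinations of these over `ψ` isolate the coefficient of any single `α₀` hitting
all nonzero values (`exists_dual`). So all such coefficients vanish.

For the rank, the maps hitting all nonzero values form a basis of `F_T(X)/H_T(X)`, and
inclusion–exclusion counts them. -/

open Classical in
/-- The action of a correspondence on maps to a lattice, for sets in arbitrary universes. -/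
noncomputable def joinAct {T : Type*} [Lattice T] [OrderBot T] {Y X : Type*} [Fintype X]
    (Q : Corr Y X) (φ : X → T) : Y → T := fun y =>
  (Finset.univ.filter fun x : X => (y, x) ∈ Q).sup φ

theorem joinAct_le_iff {T : Type*} [Lattice T] [OrderBot T] {Y X : Type*} [Fintype X]
    (Q : Corr Y X) (φ : X → T) (y : Y) (a : T) :
    joinAct Q φ y ≤ a ↔ ∀ x : X, (y, x) ∈ Q → φ x ≤ a := by
  simp [joinAct]

theorem joinAct_comp {T : Type*} [Lattice T] [OrderBot T] {Z Y X : Type*} [Fintype Y] [Fintype X]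
    (R : Corr Z Y) (S : Corr Y X) (φ : X → T) :
    joinAct (Corr.comp R S) φ = joinAct R (joinAct S φ) := by
  funext z
  apply eq_of_forall_ge_iff
  intro a
  simp only [joinAct_le_iff]
  constructor
  · intro h y hy x hx
    exact h x ⟨y, hy, hx⟩
  · rintro h x ⟨y, hy, hx⟩
    exact h y hy x hx

theorem le_joinAct {T : Type*} [Lattice T] [OrderBot T] {Y X : Type*} [Fintype X]
    {Q : Corr Y X} {y : Y} {x : X} (h : (y, x) ∈ Q) (φ : X → T) : φ x ≤ joinAct Q φ y :=
  (joinAct_le_iff Q φ y _).1 le_rfl x h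

theorem le_joinAct_iff {T : Type*} [LinearOrder T] [OrderBot T] {Y X : Type*} [Fintype X]
    (Q : Corr Y X) (φ : X → T) (y : Y) {a : T} (ha : a ≠ ⊥) :
    a ≤ joinAct Q φ y ↔ ∃ x : X, (y, x) ∈ Q ∧ a ≤ φ x := by
  simp [joinAct, Finset.le_sup_iff (bot_lt_iff_ne_bot.2 ha)]

theorem joinAct_lt_iff {T : Type*} [LinearOrder T] [OrderBot T] {Y X : Type*} [Fintype X]
    (Q : Corr Y X) (φ : X → T) (y : Y) {a : T} (ha : a ≠ ⊥) :
    joinAct Q φ y < a ↔ ∀ x : X, (y, x) ∈ Q → φ x < a := by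
  simp [joinAct, Finset.sup_lt_iff (bot_lt_iff_ne_bot.2 ha)]

/-- The condition that a map hits every element except possibly the least one. -/
def CoversNonBot {T : Type*} [Bot T] {X : Type*} (α : X → T) : Prop :=
  ∀ a : T, a ≠ ⊥ → a ∈ Set.range α

/-- In a chain a finite join different from `⊥` is attained by one of its terms, so acting by `Q`
creates no new non-minimal values. -/
theorem CoversNonBot.of_joinAct {T : Type*} [LinearOrder T] [OrderBot T] {Y X : Type*} [Fintype X]
    {Q : Corr Y X} {α : X → T} (h : CoversNonBot (joinAct Q α)) : CoversNonBot α := by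
  intro a ha
  obtain ⟨y, hy⟩ := h a ha
  obtain ⟨x, hx, hax⟩ := (le_joinAct_iff Q α y ha).1 hy.ge
  exact ⟨x, le_antisymm ((le_joinAct hx α).trans hy.le) hax⟩

/-- In a chain the join-irreducible elements are exactly the non-minimal ones. -/
theorem supIrred_subset_range_iff {T : Type*} [LinearOrder T] [OrderBot T] {X : Type*}
    (α : X → T) : {a : T | SupIrred a} ⊆ Set.range α ↔ CoversNonBot α := by
  simp [Set.subset_def, CoversNonBot]

theorem latticeSub_eq_supported (k : Type u) [CommRing k] (T : Type t) [LinearOrder T]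
    [OrderBot T] (X : FinCorr.{w}) :
    latticeSub k T X = Finsupp.supported k k {α : X → T | ¬ CoversNonBot α} := by
  rw [Finsupp.supported_eq_span_single, latticeSub]
  congr 1
  ext v
  constructor
  · rintro ⟨φ, hφ, rfl⟩
    exact ⟨φ, (supIrred_subset_range_iff φ).not.1 hφ, rfl⟩
  · rintro ⟨φ, hφ, rfl⟩
    exact ⟨φ, (supIrred_subset_range_iff φ).not.2 hφ, rfl⟩

/-- The maps to a totally ordered lattice which miss a non-minimal element span the kernel of the restriction
to the other maps. -/
theorem latticeSub_eq_ker (k : Type u) [CommRing k] (T : Type t) [LinearOrder T]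
    [OrderBot T] (X : FinCorr.{w}) :
    latticeSub k T X = LinearMap.ker
      (Finsupp.lsubtypeDomain (M := k) (R := k) {α : X → T | CoversNonBot α}) := by
  rw [latticeSub_eq_supported]
  ext v
  change v ∈ Finsupp.supported k k {α : X → T | ¬ CoversNonBot α} ↔ _
  rw [Finsupp.mem_supported', LinearMap.mem_ker, Finsupp.ext_iff]
  simp only [Set.mem_ofPred_eq, not_not, Subtype.forall]
  rfl

/-! ### Counting the maps which hit all non-minimal elements -/

/-- Inclusion–exclusion over the set `t` of nonzero values that are missed: `(n + 1 - |t|) ^ |X|`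
maps avoid `t`. -/
theorem card_coversNonBot (n : ℕ) (X : Type*) [Fintype X] :
    (Nat.card {α : X → Fin (n + 1) // CoversNonBot α} : ℤ) = ∑ i ∈ Finset.range (n + 1),
      (-1 : ℤ) ^ (n - i) * (n.choose i : ℤ) * ((i : ℤ) + 1) ^ Fintype.card X := by
  classical
  let S : Fin (n + 1) → Finset (X → Fin (n + 1)) := fun a => {α | a ∉ Set.range α}
  let s : Finset (Fin (n + 1)) := Finset.univ.erase 0
  have hs : s.card = n := by simp [s]
  have key := Finset.inclusion_exclusion_card_inf_compl s S
  have h1 : (Nat.card {α : X → Fin (n + 1) // CoversNonBot α}) = (s.inf fun i => (S i)ᶜ).card := by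
    rw [Nat.card_eq_fintype_card, Fintype.card_subtype]
    congr 1
    ext α
    simp [Finset.mem_inf, S, s, CoversNonBot, bot_eq_zero]
  have h2 (t : Finset (Fin (n + 1))) : (t.inf S).card = (n + 1 - t.card) ^ Fintype.card X := by
    have : t.inf S = Fintype.piFinset fun _ : X => tᶜ := by
      ext α
      simp only [Finset.mem_inf, S, Finset.mem_filter, Finset.mem_univ, true_and, Set.mem_range,
        not_exists, Fintype.mem_piFinset, Finset.mem_compl]
      exact ⟨fun h x hx => h _ hx x rfl, fun h a ha x hx => h x (hx ▸ ha)⟩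
    rw [this, Fintype.card_piFinset]
    simp [Finset.card_compl]
  rw [h1, key]
  simp only [h2]
  -- Group the sets `t` by size, then substitute `i = n - |t|`.
  rw [Finset.sum_powerset_apply_card
    (fun m => (-1 : ℤ) ^ m * (((n + 1 - m) ^ Fintype.card X : ℕ) : ℤ)) , hs,
    ← Finset.sum_range_reflect]
  refine Finset.sum_congr rfl fun i hi => ?_
  have hi : i ≤ n := by simpa [Nat.lt_succ_iff] using hi
  rw [show n + 1 - 1 - i = n - i by omega, Nat.choose_symm hi,
    show n + 1 - (n - i) = i + 1 by omega]
  push_cast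
  rw [nsmul_eq_mul]
  ring

/-! ### Duality -/

/-- Möbius inversion in the Boolean lattice of subsets of `X`. -/
theorem exists_sum_subset_eq_indicator (k : Type*) [CommRing k] {X : Type*} [Fintype X]
    [DecidableEq X] (s : Finset X) :
    ∃ c : Finset X → k, ∀ D : Finset X,
      ∑ A, c A * (if A ⊆ D then 1 else 0) = if D = s then 1 else 0 := by
  refine ⟨fun A => if s ⊆ A then IncidenceAlgebra.mu k s A else 0, fun D => ?_⟩
  have h := IncidenceAlgebra.sum_Icc_mu_right (𝕜 := k) s D
  simp only [eq_comm (a := D)]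
  rw [← h, Finset.Icc_eq_filter_powerset, Finset.sum_filter]
  simp only [mul_ite, mul_one, mul_zero]
  rw [← Finset.sum_filter]
  refine Finset.sum_congr ?_ fun _ _ => rfl
  ext A
  simp

/-- The correspondence with prescribed sections. -/
def Corr.ofSections {Y X : Type*} (A : Y → Finset X) : Corr Y X := {p | p.2 ∈ A p.1}

-- For fixed `α`, the condition `Aα = γ` splits over the points of `E`: at `e` it says that the
-- section `A e` lies in `{α ≤ γ e}` but not in `{α < γ e}`. Thus `d` can be sought as a product,
-- each factor using Möbius inversion to detect the set `{α₀ < γ e}`.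
open Classical in
theorem exists_dual {T : Type*} [LinearOrder T] [OrderBot T] [WellFoundedGT T]
    (k : Type*) [CommRing k] {E X : Type*}
    [Fintype E] [Fintype X] (γ : E → T) (hγ : CoversNonBot γ) (hγ' : ∀ e, γ e ≠ ⊥)
    (α₀ : X → T) (h₀ : CoversNonBot α₀) :
    ∃ d : (E → Finset X) → k, ∀ α : X → T,
      ∑ A, d A * (if joinAct (Corr.ofSections A) α = γ then 1 else 0) =
        if α = α₀ then 1 else 0 := by
  choose c hc using fun e : E =>
    exists_sum_subset_eq_indicator k (Finset.univ.filter fun x => α₀ x < γ e)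
  -- The strict sublevel set enters `h1` with a minus sign; negating `c e` makes every factor equal
  -- to 1 at `α = α₀`.
  refine ⟨fun A => ∏ e, - c e (A e), fun α => ?_⟩
  have h1 (A : E → Finset X) :
      (if joinAct (Corr.ofSections A) α = γ then (1 : k) else 0) =
        ∏ e, ((if A e ⊆ Finset.univ.filter (fun x => α x ≤ γ e) then 1 else 0) -
          (if A e ⊆ Finset.univ.filter (fun x => α x < γ e) then 1 else 0)) := by
    have h2 (e : E) : ((if A e ⊆ Finset.univ.filter (fun x => α x ≤ γ e) then (1 : k) else 0) -
          (if A e ⊆ Finset.univ.filter (fun x => α x < γ e) then 1 else 0)) =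
          if joinAct (Corr.ofSections A) α e = γ e then 1 else 0 := by
      have hle := joinAct_le_iff (Corr.ofSections A) α e (γ e)
      have hlt := joinAct_lt_iff (Corr.ofSections A) α e (hγ' e)
      have e1 : A e ⊆ Finset.univ.filter (fun x => α x ≤ γ e) ↔
          joinAct (Corr.ofSections A) α e ≤ γ e := by
        rw [hle]; simp [Finset.subset_iff, Corr.ofSections]
      have e2 : A e ⊆ Finset.univ.filter (fun x => α x < γ e) ↔
          joinAct (Corr.ofSections A) α e < γ e := by
        rw [hlt]; simp [Finset.subset_iff, Corr.ofSections]
      simp only [e1, e2]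
      rcases lt_trichotomy (joinAct (Corr.ofSections A) α e) (γ e) with h | h | h
      · simp [h, h.le, h.ne]
      · simp [h]
      · simp [h.not_ge, h.not_gt, h.ne']
    simp only [h2, Finset.prod_boole, funext_iff, Finset.mem_univ, true_imp_iff]
  simp only [h1, ← Finset.prod_mul_distrib]
  rw [← Fintype.piFinset_univ, ← Finset.prod_univ_sum (fun _ => Finset.univ) (fun e B => - c e B *
    ((if B ⊆ Finset.univ.filter (fun x => α x ≤ γ e) then 1 else 0) -
          (if B ⊆ Finset.univ.filter (fun x => α x < γ e) then 1 else 0)))]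
  have h3 (e : E) : ∑ B, - c e B *
      ((if B ⊆ Finset.univ.filter (fun x => α x ≤ γ e) then (1 : k) else 0) -
          (if B ⊆ Finset.univ.filter (fun x => α x < γ e) then 1 else 0)) =
      (if Finset.univ.filter (fun x => α x < γ e) = Finset.univ.filter (fun x => α₀ x < γ e)
        then 1 else 0) -
      (if Finset.univ.filter (fun x => α x ≤ γ e) = Finset.univ.filter (fun x => α₀ x < γ e)
        then 1 else 0) := by
    rw [← hc, ← hc, ← Finset.sum_sub_distrib]
    exact Finset.sum_congr rfl fun B _ => by ring
  simp only [h3]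
  split_ifs with hα
  · subst hα
    refine Finset.prod_eq_one fun e _ => ?_
    obtain ⟨x, hx⟩ := h₀ (γ e) (hγ' e)
    rw [if_pos rfl, if_neg, sub_zero]
    intro h
    have := Finset.ext_iff.1 h x
    simp [hx] at this
  · by_contra hne
    have hne' (e : E) := fun h0 => hne (Finset.prod_eq_zero (Finset.mem_univ e) h0)
    -- Nonvanishing of the factor at `e` forces `{α < γ e}` or `{α ≤ γ e}` to equal `{α₀ < γ e}`.
    -- Descending induction on the level rules out the second alternative.
    have hlt : ∀ a : T, a ≠ ⊥ → ∀ x, α x < a ↔ α₀ x < a := by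
      intro a
      induction a using WellFoundedGT.induction with
      | ind a ih =>
        intro ha x
        obtain ⟨e, rfl⟩ := hγ a ha
        by_cases h4 : Finset.univ.filter (fun x => α x < γ e) =
          Finset.univ.filter (fun x => α₀ x < γ e)
        · simpa using Finset.ext_iff.1 h4 x
        by_cases h5 : Finset.univ.filter (fun x => α x ≤ γ e) =
          Finset.univ.filter (fun x => α₀ x < γ e)
        -- Here `α₀ y = γ e < α y`, which contradicts the induction hypothesis at the higher level
        -- `α y`.
        · obtain ⟨y, hy⟩ := h₀ (γ e) ha
          have h6 := Finset.ext_iff.1 h5 y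
          simp only [Finset.mem_filter, Finset.mem_univ, true_and, hy, lt_irrefl, iff_false,
            not_le] at h6
          exact absurd ((ih _ h6 (bot_le.trans_lt h6).ne' y).2 (hy ▸ h6)) (lt_irrefl _)
        · exact absurd (by rw [if_neg h4, if_neg h5, sub_zero]) (hne' e)
    refine hα (funext fun x => le_antisymm ?_ ?_)
    · by_contra! h
      exact lt_irrefl _ ((hlt _ (bot_le.trans_lt h).ne' x).2 h)
    · by_contra! h
      exact lt_irrefl _ ((hlt _ (bot_le.trans_lt h).ne' x).1 h)

/-! ### The action of the algebra of permuted orders -/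

section Action

variable (k : Type u) [CommRing k] (T : Type t) [LinearOrder T] [OrderBot T]

/-- The value of `F_T / H_T` at a finite set. -/
noncomputable abbrev LatticeQuot (X : FinCorr.{w}) :=
  ((quotientFunctor (latticeFunctor k T) (latticeSub k T) (latticeSub_le k T)).obj X)

/-- The class of a map in `F_T / H_T`. -/
noncomputable def LatticeQuot.of {X : FinCorr.{w}} (α : X → T) : LatticeQuot k T X :=
  (latticeSub k T X).mkQ (Finsupp.single α (1 : k))

variable {T} in
theorem LatticeQuot.of_eq_zero {X : FinCorr.{w}} {α : X → T} (h : ¬ CoversNonBot α) :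
    LatticeQuot.of k T α = 0 := by
  refine (Submodule.Quotient.mk_eq_zero _).2 (Submodule.subset_span ⟨α, ?_, rfl⟩)
  rwa [supIrred_subset_range_iff]

variable {k T} in
theorem LatticeQuot.hom_ext {X : FinCorr.{w}} {M : Type*} [AddCommGroup M] [Module k M]
    {f g : LatticeQuot k T X →ₗ[k] M}
    (h : ∀ α : X → T, f (LatticeQuot.of k T α) = g (LatticeQuot.of k T α)) : f = g := by
  apply Submodule.linearMap_qext
  apply Finsupp.lhom_ext'
  intro α
  apply LinearMap.ext_ring
  exact h α

/-- The action of the monoid of relations on `F_T(E) / H_T(E)`. -/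
noncomputable def latticeRep (E : FinCorr.{w}) : Corr E E →* Module.End k (LatticeQuot k T E) where
  toFun Q := ((quotientFunctor (latticeFunctor k T) (latticeSub k T) (latticeSub_le k T)).map
    (show E ⟶ E from Q)).hom
  map_one' := by
    change ((quotientFunctor (latticeFunctor k T) (latticeSub k T)
      (latticeSub_le k T)).map (𝟙 E)).hom = _
    rw [CategoryTheory.Functor.map_id]
    rfl
  map_mul' Q P := by
    change ((quotientFunctor (latticeFunctor k T) (latticeSub k T)
      (latticeSub_le k T)).map ((show E ⟶ E from P) ≫ (show E ⟶ E from Q))).hom = _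
    rw [Functor.map_comp]
    rfl

theorem quotientFunctor_map_of {X Y : FinCorr.{w}} (Q : Corr Y X) (α : X → T) :
    ((quotientFunctor (latticeFunctor k T) (latticeSub k T) (latticeSub_le k T)).map
      (show X ⟶ Y from Q)).hom (LatticeQuot.of k T α) = LatticeQuot.of k T (joinAct Q α) := by
  change (latticeSub k T Y).mkQ (Finsupp.mapDomain (act T Q) (Finsupp.single α 1)) = _
  rw [Finsupp.mapDomain_single]
  rfl

theorem latticeRep_of {E : FinCorr.{w}} (Q : Corr E E) (α : E → T) :
    latticeRep k T E Q (LatticeQuot.of k T α) = LatticeQuot.of k T (joinAct Q α) :=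
  quotientFunctor_map_of k T Q α

variable {T} in
theorem card_le_of_coversNonBot {Y E : Type*} [Finite Y] [Finite E] {β : Y → T} {γ : E → T}
    (hβ : CoversNonBot β) (hγ : Function.Injective γ) (hγ' : ∀ e, γ e ≠ ⊥) :
    Nat.card E ≤ Nat.card Y := by
  choose f hf using fun e => hβ (γ e) (hγ' e)
  exact Nat.card_le_card_of_injective f fun a b h => hγ (by rw [← hf, ← hf, h])

variable {T} in
-- By counting, `α` and `β` are both injective with image `γ(E)`, so they differ by a permutation of
-- a finite set. Descending induction on the value of `β` then shows that `α ≤ β` leaves no room for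
-- a strict inequality.
theorem eq_of_coversNonBot_of_le {E : Type*} [Finite E] {α β : E → T} {γ : E → T}
    (hγ : Function.Injective γ) (hγ' : ∀ e, γ e ≠ ⊥) (hα : CoversNonBot α)
    (hβ : CoversNonBot β) (h : α ≤ β) : α = β := by
  classical
  have := Fintype.ofFinite E
  have key {δ : E → T} (hδ : CoversNonBot δ) : Function.Injective δ ∧
      Finset.univ.image δ = Finset.univ.image γ := by
    have hsub : Finset.univ.image γ ⊆ Finset.univ.image δ := by
      intro a ha
      obtain ⟨e, -, rfl⟩ := Finset.mem_image.1 ha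
      obtain ⟨x, hx⟩ := hδ _ (hγ' e)
      exact Finset.mem_image.2 ⟨x, Finset.mem_univ _, hx⟩
    have hcard : (Finset.univ.image δ).card ≤ (Finset.univ.image γ).card := by
      rw [Finset.card_image_of_injective _ hγ]
      exact Finset.card_image_le
    have heq := Finset.eq_of_subset_of_card_le hsub hcard
    refine ⟨?_, heq.symm⟩
    rw [← Set.injOn_univ, ← Finset.coe_univ, ← Finset.card_image_iff, ← heq,
      Finset.card_image_of_injective _ hγ]
  obtain ⟨hα1, hα2⟩ := key hα
  obtain ⟨hβ1, hβ2⟩ := key hβ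
  choose σ hσ using fun e => hα (β e) (by
    have : β e ∈ Finset.univ.image γ := hβ2 ▸ Finset.mem_image_of_mem _ (Finset.mem_univ e)
    obtain ⟨x, -, hx⟩ := Finset.mem_image.1 this
    exact hx ▸ hγ' x)
  have hlt : ∀ a : E, α a = β a := by
    have wf : WellFounded (fun a b : E => β b < β a) :=
      have : IsTrans E (fun a b : E => β b < β a) := ⟨fun _ _ _ h h' => h'.trans h⟩
      have : Std.Irrefl (fun a b : E => β b < β a) := ⟨fun _ => lt_irrefl _⟩
      Finite.wellFounded_of_trans_of_irrefl _
    intro a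
    induction a using wf.induction with
    | _ a ih =>
      by_contra hne
      have h1 : β a < β (σ a) := by
        refine lt_of_le_of_ne ((hσ a).symm.le.trans (h _)) fun h2 => hne ?_
        have h3 := hσ a
        rwa [← hβ1 h2] at h3
      exact h1.ne (by rw [← hσ a, ih _ h1])
  exact funext hlt

theorem le_joinAct_of_reflexive {E : Type*} [Fintype E] {S : Corr E E} (hS : ∀ a, (a, a) ∈ S)
    (α : E → T) : α ≤ joinAct S α := fun a => le_joinAct (hS a) α

theorem joinAct_transClosure_of_eq {E : Type*} [Fintype E] {S : Corr E E}
    (hS : ∀ a, (a, a) ∈ S) {α : E → T} (h : joinAct S α = α) :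
    joinAct (transClosure S) α = α := by
  refine le_antisymm (fun a => (joinAct_le_iff _ _ _ _).2 fun b hb => ?_)
    (le_joinAct_of_reflexive T (fun a => .single (hS a)) α)
  replace hb : Relation.TransGen (fun a b => (a, b) ∈ S) a b := hb
  induction hb with
  | single h1 => exact (le_joinAct h1 α).trans (congrFun h a).le
  | tail _ h1 ih => exact ((le_joinAct h1 α).trans (congrFun h _).le).trans ih

variable {T}

theorem latticeRep_inessential {E : FinCorr.{w}} {γ : E → T} (hγ : Function.Injective γ)
    (hγ' : ∀ e, γ e ≠ ⊥) {Q : Corr E E} (hQ : Inessential Q) : latticeRep k T E Q = 0 := by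
  obtain ⟨Y, hY, A, B, hc, rfl⟩ := hQ
  have := Fintype.ofFinite Y
  refine LatticeQuot.hom_ext fun α => ?_
  rw [latticeRep_of, LinearMap.zero_apply, joinAct_comp]
  refine LatticeQuot.of_eq_zero k fun h => ?_
  exact absurd (card_le_of_coversNonBot h.of_joinAct hγ hγ') hc.not_ge

/-- A reflexive relation only enlarges a map, so by `eq_of_coversNonBot_of_le` it either fixes `α`
or sends it to a map that is zero in the quotient. A map is fixed by `S` exactly when it is fixed by
the transitive closure. -/
theorem latticeRep_transClosure {E : FinCorr.{w}} {γ : E → T} (hγ : Function.Injective γ)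
    (hγ' : ∀ e, γ e ≠ ⊥) {S : Corr E E} (hS : ∀ a : E, (a, a) ∈ S) :
    latticeRep k T E S = latticeRep k T E (transClosure S) := by
  refine LatticeQuot.hom_ext fun α => ?_
  rw [latticeRep_of, latticeRep_of]
  have hS' : ∀ a : E, (a, a) ∈ transClosure S := fun a => .single (hS a)
  by_cases h1 : CoversNonBot (joinAct S α)
  · have h := eq_of_coversNonBot_of_le hγ hγ' h1.of_joinAct h1 (le_joinAct_of_reflexive T hS α)
    rw [joinAct_transClosure_of_eq T hS h.symm, ← h]
  · rw [LatticeQuot.of_eq_zero k h1]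
    by_cases h2 : CoversNonBot (joinAct (transClosure S) α)
    · have h := eq_of_coversNonBot_of_le hγ hγ' h2.of_joinAct h2
        (le_joinAct_of_reflexive T hS' α)
      refine absurd ?_ h1
      convert h2.of_joinAct using 1
      -- `S α` is squeezed between `α` and its image under the closure, which equals `α`.
      refine le_antisymm (le_trans (fun a => ?_) h.ge) (le_joinAct_of_reflexive T hS α)
      exact (joinAct_le_iff _ _ _ _).2 fun b hb =>
        le_joinAct (show (a, b) ∈ transClosure S from .single hb) α
    · rw [LatticeQuot.of_eq_zero k h2]

/-- The action of the algebra of permuted orders on `F_T(E) / H_T(E)`. -/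
noncomputable def permutedRep {E : FinCorr.{w}} {γ : E → T} (hγ : Function.Injective γ)
    (hγ' : ∀ e, γ e ≠ ⊥) : PermutedOrders k E →ₐ[k] Module.End k (LatticeQuot k T E) :=
  RingQuot.liftAlgHom k ⟨MonoidAlgebra.lift k _ _ (latticeRep k T E), by
    intro x y hxy
    cases hxy with
    | inessential Q hQ => simp [latticeRep_inessential k hγ hγ' hQ]
    | closure S hS => simp [latticeRep_transClosure k hγ hγ' hS]⟩

theorem permutedRep_permutedClass {E : FinCorr.{w}} {γ : E → T} (hγ : Function.Injective γ)
    (hγ' : ∀ e, γ e ≠ ⊥) (Q : Corr E E) :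
    permutedRep k hγ hγ' (permutedClass k E Q) = latticeRep k T E Q := by
  change RingQuot.liftAlgHom k _ (RingQuot.mkAlgHom k _ (MonoidAlgebra.of k _ Q)) = _
  rw [RingQuot.liftAlgHom_mkAlgHom_apply]
  simp

/-- The coefficient of a map hitting all non-minimal elements. -/
noncomputable def LatticeQuot.coeff {X : FinCorr.{w}} {α : X → T} (hα : CoversNonBot α) :
    LatticeQuot k T X →ₗ[k] k :=
  (latticeSub k T X).liftQ (Finsupp.lapply α) (by
    rw [latticeSub_eq_supported]
    intro v hv
    exact (Finsupp.mem_supported' k v).1 hv α (by simpa using hα))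

open Classical in
theorem LatticeQuot.coeff_of {X : FinCorr.{w}} {α : X → T} (hα : CoversNonBot α) (β : X → T) :
    LatticeQuot.coeff k hα (LatticeQuot.of k T β) = if β = α then 1 else 0 := by
  change Finsupp.single β (1 : k) α = _
  rw [Finsupp.single_apply]

open Classical in
/-- The coefficient of `γ` in the image of `γ` under the action of an element of `𝒫_E`. -/
theorem exists_functional {E : Type w} [Fintype E] {γ : E → T} (hγ : Function.Injective γ)
    (hγ' : ∀ e, γ e ≠ ⊥) (hγ'' : CoversNonBot γ) :
    ∃ l : PermutedOrders k E →ₗ[k] k, ∀ Q : Corr E E,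
      l (permutedClass k E Q) = if joinAct Q γ = γ then 1 else 0 := by
  let E' : FinCorr.{w} := ⟨E⟩
  refine ⟨LatticeQuot.coeff k (X := E') hγ'' ∘ₗ
    (LinearMap.applyₗ (LatticeQuot.of k T (X := E') γ)) ∘ₗ
    (permutedRep k (E := E') hγ hγ').toLinearMap, fun Q => ?_⟩
  simp only [LinearMap.comp_apply, AlgHom.toLinearMap_apply, LinearMap.applyₗ_apply_apply]
  rw [← LatticeQuot.coeff_of k (X := E') hγ'', ← latticeRep_of,
    ← permutedRep_permutedClass k (E := E') hγ hγ']

end Action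

theorem permutedClass_inessential (k : Type u) [CommRing k] {E : Type e} {Q : Corr E E}
    (hQ : Inessential Q) : permutedClass k E Q = 0 :=
  (RingQuot.mkAlgHom_rel k (PermutedRel.inessential Q hQ)).trans (map_zero _)

/-- Maximality leaves only the term `S = R`, with `μ(R, R) = 1`. -/
theorem fElement_eq_of_maximal (k : Type u) [CommRing k] {E : Type e} [Finite E]
    {R : OrderRel E} (hR : IsMax R) : fElement k R = permutedClass k E R.rel := by
  classical
  have h : (Finset.univ.filter fun S : OrderRel E => R ≤ S) = {R} := by
    ext S
    simpa using ⟨fun h => (hR h).antisymm h, fun h => h ▸ le_rfl⟩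
  rw [fElement, Finset.sum_congr (by convert h) fun _ _ => rfl, Finset.sum_singleton,
    IncidenceAlgebra.mu_self, one_smul]

theorem isMax_ofLE (E : Type e) [LinearOrder E] : IsMax (OrderRel.ofLE E) := by
  rintro S hS ⟨a, b⟩ hab
  rcases le_total a b with h | h
  · exact h
  · have hba : (b, a) ∈ S.1 := hS (show (b, a) ∈ (OrderRel.ofLE E).1 from h)
    obtain rfl := S.2.2.1 a b hab hba
    exact le_refl a

/-! ### The two presentations of the functor -/

section Presentation

variable (k : Type u) [CommRing k] {T : Type t} [LinearOrder T] [OrderBot T]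
  {E : Type} [Fintype E] {γ : E → T}

/-- The map `k𝒞(X, E) → F_T(X) / H_T(X)` given by the action on a fixed map `γ : E → T`. -/
noncomputable def toLatticeQuot (γ : E → T) (X : FinCorr.{w}) :
    (Corr X E →₀ k) →ₗ[k] LatticeQuot k T X :=
  (latticeSub k T X).mkQ ∘ₗ Finsupp.lmapDomain k k (fun φ : Corr X E => joinAct φ γ)

theorem toLatticeQuot_single (X : FinCorr.{w}) (φ : Corr X E) :
    toLatticeQuot k γ X (Finsupp.single φ 1) = LatticeQuot.of k T (joinAct φ γ) := by
  change (latticeSub k T X).mkQ (Finsupp.mapDomain _ (Finsupp.single φ 1)) = _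
  rw [Finsupp.mapDomain_single]
  rfl

/-- The correspondence `{(x, e) | γ(e) ≤ α(x)}`. -/
def levelCorr (γ : E → T) {X : Type*} (α : X → T) : Corr X E := {p | γ p.2 ≤ α p.1}

theorem joinAct_levelCorr (hγ'' : CoversNonBot γ) {X : Type*} (α : X → T) :
    joinAct (levelCorr γ α) γ = α := by
  funext x
  refine le_antisymm ((joinAct_le_iff _ _ _ _).2 fun _ h => h) ?_
  by_cases hx : α x = ⊥
  · rw [hx]; exact bot_le
  · obtain ⟨e, he⟩ := hγ'' _ hx
    rw [le_joinAct_iff _ _ _ hx]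
    exact ⟨e, he.le, he.ge⟩

theorem toLatticeQuot_surjective (hγ'' : CoversNonBot γ) (X : FinCorr.{w}) :
    Function.Surjective (toLatticeQuot k γ X) := by
  refine (Submodule.mkQ_surjective _).comp ?_
  exact Finsupp.mapDomain_surjective fun α => ⟨levelCorr γ α, joinAct_levelCorr hγ'' α⟩

variable [LinearOrder E]

/-- Composing with the order closes each section of `φ` upwards in `E`; as `γ` reverses order, these
up-sets are the sets `{γ e ≤ a}`. -/
theorem comp_ofLE (hγ : StrictAnti γ) (hγ' : ∀ e, γ e ≠ ⊥) {X : Type*} (φ : Corr X E) :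
    Corr.comp φ (OrderRel.ofLE E).rel = levelCorr γ (joinAct φ γ) := by
  ext ⟨x, e⟩
  change (∃ e', (x, e') ∈ φ ∧ e' ≤ e) ↔ γ e ≤ joinAct φ γ x
  simp [le_joinAct_iff _ _ _ (hγ' e), hγ.le_iff_ge]

/-- If `γ e₀` is not a value of `α`, the relation `γ e ≤ α x` factors through the point `e' ≠ e₀`
with `γ e' = α x`. When `α x = ⊥` no `e` is related to `x`. -/
theorem inessential_comp_levelCorr (hγ' : ∀ e, γ e ≠ ⊥)
    (hγ'' : CoversNonBot γ) {X : Type*} {α : X → T} (hα : ¬ CoversNonBot α) (ψ : Corr E X) :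
    Inessential (Corr.comp ψ (levelCorr γ α)) := by
  simp only [CoversNonBot, not_forall] at hα
  obtain ⟨a, ha, hα⟩ := hα
  obtain ⟨e₀, rfl⟩ := hγ'' a ha
  refine ⟨{e : E // e ≠ e₀}, inferInstance, Corr.comp ψ {p : X × {e : E // e ≠ e₀} | γ p.2 = α p.1},
    {p | γ p.2 ≤ γ p.1}, ?_, ?_⟩
  · rw [Nat.card_eq_fintype_card, Nat.card_eq_fintype_card]
    exact Fintype.card_subtype_lt (x := e₀) (by simp)
  · rw [Corr.comp_assoc]
    congr 1
    ext ⟨x, e⟩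
    constructor
    · intro h
      have h : γ e ≤ α x := h
      obtain ⟨e', he'⟩ := hγ'' (α x) fun h0 => hγ' e (le_bot_iff.1 (h0 ▸ h))
      refine ⟨⟨e', ?_⟩, he', he' ▸ h⟩
      rintro rfl
      exact hα ⟨x, he'.symm⟩
    · rintro ⟨e', h1, h2⟩
      exact le_of_le_of_eq h2 h1

/-- The relations among the generators `φ ∈ 𝒞(X, E)` of `F_T(X) / H_T(X)`, detected in `𝒫_E`. -/
theorem toLatticeQuot_eq_zero_iff [WellFoundedGT T] (hγ : StrictAnti γ) (hγ' : ∀ e, γ e ≠ ⊥)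
    (hγ'' : CoversNonBot γ) (X : FinCorr.{w}) (z : Corr X E →₀ k) :
    toLatticeQuot k γ X z = 0 ↔ ∀ ψ : Corr E X, Finsupp.linearCombination k
      (fun φ : Corr X E => permutedClass k E
        (Corr.comp ψ (Corr.comp φ (OrderRel.ofLE E).rel))) z = 0 := by
  classical
  have hz : toLatticeQuot k γ X z = 0 ↔
      Finsupp.mapDomain (fun φ : Corr X E => joinAct φ γ) z ∈ latticeSub k T X :=
    Submodule.Quotient.mk_eq_zero _
  have hR (ψ : Corr E X) : Finsupp.linearCombination k
      (fun φ : Corr X E => permutedClass k E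
        (Corr.comp ψ (Corr.comp φ (OrderRel.ofLE E).rel))) z =
      Finsupp.linearCombination k
        (fun α : X → T => permutedClass k E (Corr.comp ψ (levelCorr γ α)))
        (Finsupp.mapDomain (fun φ : Corr X E => joinAct φ γ) z) := by
    rw [Finsupp.linearCombination_mapDomain]
    simp only [comp_ofLE hγ hγ']
    rfl
  simp only [hz, hR]
  generalize (Finsupp.mapDomain (fun φ : Corr X E => joinAct φ γ) z) = v
  constructor
  · intro hv ψ
    refine (Submodule.span_le (p := LinearMap.ker (Finsupp.linearCombination k
      (fun α : X → T => permutedClass k E (Corr.comp ψ (levelCorr γ α)))))).2 ?_ hv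
    rintro _ ⟨α, hα, rfl⟩
    rw [supIrred_subset_range_iff] at hα
    rw [SetLike.mem_coe, LinearMap.mem_ker, Finsupp.linearCombination_single, one_smul]
    exact permutedClass_inessential k (inessential_comp_levelCorr hγ' hγ'' hα ψ)
  · intro h
    obtain ⟨l, hl⟩ := exists_functional k hγ.injective hγ' hγ''
    rw [latticeSub_eq_supported]
    refine (Finsupp.mem_supported' k v).2 fun α₀ hα₀ => ?_
    obtain ⟨d, hd⟩ := exists_dual k γ hγ'' hγ' α₀ (by simpa using hα₀)
    -- Apply `l` to the relation for `ψ`: the level correspondence of `α` sends `γ` to `α`, so `l`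
    -- tests whether `ψα = γ`.
    have h1 (ψ : Corr E X) : v.sum (fun α c => c * if joinAct ψ α = γ then 1 else 0) = 0 := by
      have := congrArg l (h ψ)
      rw [map_zero, Finsupp.apply_linearCombination, Finsupp.linearCombination_apply] at this
      simpa only [Function.comp_def, hl, joinAct_comp, joinAct_levelCorr hγ'', smul_eq_mul]
        using this
    calc v α₀ = v.sum (fun α c => c * if α = α₀ then 1 else 0) := by
          simp [Finsupp.sum]
      _ = v.sum (fun α c => ∑ A, d A *
            (c * if joinAct (Corr.ofSections A) α = γ then 1 else 0)) := by
          refine Finsupp.sum_congr fun α _ => ?_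
          rw [← hd, Finset.mul_sum]
          exact Finset.sum_congr (by congr!) fun A _ => by ring
      _ = ∑ A, d A * v.sum (fun α c =>
            c * if joinAct (Corr.ofSections A) α = γ then 1 else 0) := by
          rw [Finsupp.sum, Finset.sum_comm]
          refine Finset.sum_congr (by congr!) fun A _ => ?_
          rw [Finsupp.sum, Finset.mul_sum]
      _ = 0 := by simp only [h1, mul_zero, Finset.sum_const_zero]

end Presentation

/-! ### Presentation of `L/J` from a generator of the module -/

section Generator

variable {k : Type u} [CommRing k] {E : Type e} {W : Type t} [AddCommGroup W] [Module k W]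
  (ρ : Representation k (Corr E E) W) (v : W)

/-- The map `k𝒞(X, E) → L(X) / J(X)` sending `φ` to the class of `φ ⊗ v`. -/
noncomputable def toLJ (X : FinCorr.{w}) :
    (Corr X E →₀ k) →ₗ[k] LModule ρ X ⧸ JModule ρ X :=
  (JModule ρ X).mkQ ∘ₗ (balanced ρ X).mkQ ∘ₗ TensorProduct.mk k W (Corr X E →₀ k) v

/-- Already in `L(X)`, `φ ⊗ Qv = φQ ⊗ v`, so tensors with the generator `v` suffice. -/
theorem toLJ_surjective (hv : ⊤ ≤ Submodule.span k (Set.range fun Q : Corr E E => ρ Q v))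
    (X : FinCorr.{w}) : Function.Surjective (toLJ ρ v X) := by
  refine (Submodule.mkQ_surjective _).comp (LinearMap.range_eq_top.1 (eq_top_iff.2 ?_))
  rintro z -
  obtain ⟨x, rfl⟩ := Submodule.mkQ_surjective _ z
  induction x using TensorProduct.induction_on with
  | zero => simp
  | add x y hx hy => rw [map_add]; exact add_mem hx hy
  | tmul u ξ =>
    induction ξ using Finsupp.induction_linear with
    | zero => simp
    | add x y hx hy => rw [TensorProduct.tmul_add, map_add]; exact add_mem hx hy
    | single φ c =>
      have hu := hv (Submodule.mem_top (x := u))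
      induction hu using Submodule.span_induction with
      | zero => simp
      | add x y _ _ hx hy => rw [TensorProduct.add_tmul, map_add]; exact add_mem hx hy
      | smul a x _ hx => rw [← TensorProduct.smul_tmul', map_smul]; exact Submodule.smul_mem _ a hx
      | mem x hx =>
        obtain ⟨Q, rfl⟩ := hx
        refine ⟨Finsupp.single (Corr.comp φ Q) c, ?_⟩
        rw [LinearMap.comp_apply, TensorProduct.mk_apply, ← sub_eq_zero, ← map_sub]
        refine (Submodule.Quotient.mk_eq_zero _).2 ?_
        have h := Submodule.smul_mem (balanced ρ X) c (Submodule.subset_span ⟨φ, Q, v, rfl⟩)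
        rwa [smul_sub, ← TensorProduct.tmul_smul, ← TensorProduct.tmul_smul, Finsupp.smul_single,
          Finsupp.smul_single, smul_eq_mul, mul_one] at h

theorem toLJ_eq_zero_iff (X : FinCorr.{w}) (z : Corr X E →₀ k) :
    toLJ ρ v X z = 0 ↔ ∀ ψ : Corr E X,
      Finsupp.linearCombination k (fun φ : Corr X E => ρ (Corr.comp ψ φ) v) z = 0 := by
  refine (Submodule.Quotient.mk_eq_zero _).trans ((mem_JModule ρ _).trans ?_)
  refine forall_congr' fun ψ => ?_
  have h : pairing ρ ψ ∘ₗ (balanced ρ X).mkQ ∘ₗ TensorProduct.mk k W (Corr X E →₀ k) v =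
      Finsupp.linearCombination k (fun φ : Corr X E => ρ (Corr.comp ψ φ) v) := by
    apply Finsupp.lhom_ext'
    intro φ
    apply LinearMap.ext_ring
    simpa using pairing_mk ρ ψ v φ
  rw [← h]
  rfl

theorem LFunctor_quotient_map_toLJ {X Y : FinCorr.{w}} (Q : Corr Y X) (φ : Corr X E) :
    ((quotientFunctor (LFunctor ρ) (fun X => JModule ρ X) (fun _ _ f => JModule_le ρ f)).map
      (show X ⟶ Y from Q)).hom (toLJ ρ v X (Finsupp.single φ 1)) =
      toLJ ρ v Y (Finsupp.single (Corr.comp Q φ) 1) := by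
  change (JModule ρ Y).mkQ (LMap ρ Q (Submodule.Quotient.mk (v ⊗ₜ[k] Finsupp.single φ 1))) = _
  rw [LMap_mk]
  rfl

end Generator

/-! ### The fundamental module and its generator -/

section FundamentalModule

variable (k : Type u) [CommRing k] {E : Type e} [Finite E] (R : OrderRel E)

/-- The generator `f_R` of the fundamental module. -/
noncomputable def fundamentalGen : fundamentalModule k R :=
  ⟨fElement k R, Ideal.subset_span rfl⟩

theorem span_fundamentalGen : ⊤ ≤ Submodule.span k
    (Set.range fun Q : Corr E E => fundamentalRep k R Q (fundamentalGen k R)) := by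
  rintro ⟨v, hv⟩ -
  obtain ⟨b, rfl⟩ := Ideal.mem_span_singleton'.1 hv
  obtain ⟨a, rfl⟩ := RingQuot.mkAlgHom_surjective k _ b
  have h : (⟨_, hv⟩ : fundamentalModule k R) =
      (RingQuot.mkAlgHom k (PermutedRel k E) a) • fundamentalGen k R := rfl
  rw [h]
  clear h hv
  induction a using MonoidAlgebra.induction_linear with
  | zero => simp
  | add a b ha hb => rw [map_add, add_smul]; exact add_mem ha hb
  | single Q c =>
    have hc : MonoidAlgebra.single Q c = c • MonoidAlgebra.of k (Corr E E) Q := by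
      simp
    rw [hc, map_smul, smul_assoc]
    exact Submodule.smul_mem _ c (Submodule.subset_span ⟨Q, rfl⟩)

/-- For maximal `R` the generator is the class of `R` itself, so the pairing with `ψ` sends `φ ⊗
f_R` to the class of the single relation `ψφR`. -/
theorem toLJ_fundamentalGen_eq_zero_iff (hR : IsMax R) (X : FinCorr.{w}) (z : Corr X E →₀ k) :
    toLJ (W := fundamentalModule k R) (fundamentalRep k R) (fundamentalGen k R) X z = 0 ↔
      ∀ ψ : Corr E X, Finsupp.linearCombination k
        (fun φ : Corr X E => permutedClass k E (Corr.comp ψ (Corr.comp φ R.rel))) z = 0 := by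
  rw [toLJ_eq_zero_iff]
  refine forall_congr' fun ψ => ?_
  have h : (Submodule.subtype ((fundamentalModule k R).restrictScalars k)) ∘ₗ
      Finsupp.linearCombination k
        (fun φ : Corr X E => fundamentalRep k R (Corr.comp ψ φ) (fundamentalGen k R)) =
      Finsupp.linearCombination k
        (fun φ : Corr X E => permutedClass k E (Corr.comp ψ (Corr.comp φ R.rel))) := by
    apply Finsupp.lhom_ext'
    intro φ
    apply LinearMap.ext_ring
    refine (congrArg Subtype.val ((Finsupp.linearCombination_single k (1 : k) φ).trans
      (one_smul k _))).trans ?_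
    refine Eq.trans ?_ ((Finsupp.linearCombination_single k (1 : k) φ).trans (one_smul k _)).symm
    rw [← Corr.comp_assoc]
    change _ * fElement k R = permutedClass k E (Corr.comp ψ φ * R.rel)
    rw [fElement_eq_of_maximal k hR, map_mul]
  rw [← h, LinearMap.comp_apply]
  exact (Submodule.coe_eq_zero (p := (fundamentalModule k R).restrictScalars k)).symm

end FundamentalModule


/-! ### The isomorphism -/

theorem linearExtension_map_single {k : Type u} [CommRing k] (G : FinCorr.{w} ⥤ ModuleCat.{m} k)
    {X Y : FinCorr.{w}} (f : X ⟶ Y) :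
    (linearExtension G).obj.map (show Free.of k X ⟶ Free.of k Y from Finsupp.single f (1 : k)) =
      G.map f :=
  (Finsupp.linearCombination_single k (1 : k) f (v := fun f : X ⟶ Y => G.map f)).trans
    (one_smul k _)

/-- Linear extension respects isomorphisms. -/
noncomputable def linearExtensionIso {k : Type u} [CommRing k]
    {G G' : FinCorr.{w} ⥤ ModuleCat.{m} k} (i : G ≅ G') :
    linearExtension G ≅ linearExtension G' :=
  ObjectProperty.isoMk _ (NatIso.ofComponents
    (fun X : Free k FinCorr.{w} => i.app (show FinCorr.{w} from X)) (fun {X Y} α => by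
      have := (linearExtension G).property.1
      have := (linearExtension G').property.1
      have := (linearExtension G).property.2
      have := (linearExtension G').property.2
      induction α using Finsupp.induction_linear with
      | zero =>
        change (linearExtension G).obj.map (0 : X ⟶ Y) ≫ _ =
          _ ≫ (linearExtension G').obj.map (0 : X ⟶ Y)
        rw [Functor.map_zero, Functor.map_zero, Limits.zero_comp, Limits.comp_zero]
      | add a b ha hb =>
        change (linearExtension G).obj.map ((a : X ⟶ Y) + (b : X ⟶ Y)) ≫ _ =
          _ ≫ (linearExtension G').obj.map ((a : X ⟶ Y) + (b : X ⟶ Y))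
        rw [Functor.map_add, Functor.map_add, Preadditive.add_comp, Preadditive.comp_add, ha, hb]
      | single f r =>
        have h : (show X ⟶ Y from Finsupp.single f r) =
            r • (show X ⟶ Y from Finsupp.single f (1 : k)) :=
          (Finsupp.smul_single_one f r).symm
        change (linearExtension G).obj.map (show X ⟶ Y from Finsupp.single f r) ≫ _ =
          _ ≫ (linearExtension G').obj.map (show X ⟶ Y from Finsupp.single f r)
        rw [h, Functor.map_smul, Functor.map_smul, Linear.smul_comp, Linear.comp_smul]
        refine congrArg (r • ·) ?_
        refine (congrArg (· ≫ _) (linearExtension_map_single G f)).trans ?_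
        refine Eq.trans ?_ (congrArg (_ ≫ ·) (linearExtension_map_single G' f)).symm
        exact i.hom.naturality f))

/-- Two quotients by the same kernel are isomorphic, compatibly with the projections. -/
theorem exists_linearEquiv_of_ker_eq {k M N P : Type*} [CommRing k] [AddCommGroup M]
    [AddCommGroup N] [AddCommGroup P] [Module k M] [Module k N] [Module k P]
    (p : M →ₗ[k] N) (q : M →ₗ[k] P) (hp : Function.Surjective p) (hq : Function.Surjective q)
    (h : LinearMap.ker p = LinearMap.ker q) : ∃ i : N ≃ₗ[k] P, ∀ x, i (p x) = q x := by
  refine ⟨(p.quotKerEquivOfSurjective hp).symm ≪≫ₗ Submodule.quotEquivOfEq _ _ h ≪≫ₗ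
    q.quotKerEquivOfSurjective hq, fun x => ?_⟩
  have : (p.quotKerEquivOfSurjective hp).symm (p x) = Submodule.Quotient.mk x := by
    rw [LinearEquiv.symm_apply_eq]
    rfl
  simp only [LinearEquiv.trans_apply, this]
  rfl

theorem nonempty_latticeQuotient_iso_LJQuotient {k : Type u} [CommRing k] {T : Type}
    [LinearOrder T] [OrderBot T] {E : Type} [Fintype E] {γ : E → T} (hγ : CoversNonBot γ)
    {W : Type u} [AddCommGroup W] [Module k W] (ρ : Representation k (Corr E E) W) (v : W)
    (hv : ⊤ ≤ Submodule.span k (Set.range fun Q : Corr E E => ρ Q v))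
    (h : ∀ (X : FinCorr.{w}) (z : Corr X E →₀ k),
      toLatticeQuot k γ X z = 0 ↔ toLJ ρ v X z = 0) :
    Nonempty ((latticeQuotient k T : CorrespondenceFunctor.{u, w, max w u} k) ≅ LJQuotient ρ) := by
  have hex (X : FinCorr.{w}) := exists_linearEquiv_of_ker_eq (toLatticeQuot k γ X)
    (toLJ ρ v X) (toLatticeQuot_surjective k hγ X) (toLJ_surjective ρ v hv X) (by
      ext z
      exact h X z)
  choose i hi using hex
  refine ⟨linearExtensionIso (NatIso.ofComponents (fun X => (i X).toModuleIso) ?_)⟩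
  intro X Y Q
  apply ModuleCat.hom_ext
  apply LatticeQuot.hom_ext
  intro α
  -- Every `α` is the image of `γ` under a correspondence, so naturality need only be checked on the
  -- generators `φ`, where both functors act by composition.
  rw [← joinAct_levelCorr hγ α]
  change i Y (((quotientFunctor (latticeFunctor k T) (latticeSub k T) (latticeSub_le k T)).map
      Q).hom (LatticeQuot.of k T (joinAct (levelCorr γ α) γ))) =
    ((quotientFunctor (LFunctor ρ) (fun X => JModule ρ X) (fun _ _ f => JModule_le ρ f)).map Q).hom
      (i X (LatticeQuot.of k T (joinAct (levelCorr γ α) γ)))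
  rw [← toLatticeQuot_single, hi]
  refine Eq.trans ?_ (LFunctor_quotient_map_toLJ ρ v Q (levelCorr γ α)).symm
  rw [← hi, toLatticeQuot_single, toLatticeQuot_single, joinAct_comp]
  exact congrArg (i Y) (quotientFunctor_map_of k T Q _)

theorem nonempty_latticeQuotient_iso_fundamentalFunctor {k : Type u} [CommRing k] {T : Type}
    [LinearOrder T] [OrderBot T] [WellFoundedGT T] {E : Type} [LinearOrder E] [Fintype E]
    {γ : E → T} (hγ : StrictAnti γ) (hγ' : ∀ e, γ e ≠ ⊥) (hγ'' : CoversNonBot γ) :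
    Nonempty ((latticeQuotient k T : CorrespondenceFunctor.{u, w, max w u} k) ≅
      fundamentalFunctor k (OrderRel.ofLE E)) :=
  nonempty_latticeQuotient_iso_LJQuotient hγ'' (W := fundamentalModule k (OrderRel.ofLE E)) _ _
    (span_fundamentalGen k (OrderRel.ofLE E)) fun X z =>
      (toLatticeQuot_eq_zero_iff k hγ hγ' hγ'' X z).trans
        (toLJ_fundamentalGen_eq_zero_iff k _ (isMax_ofLE E) X z).symm

/-! ### The values of the functor -/

/-- `H_T(X)` is spanned by part of the standard basis of `F_T(X)`; the remaining maps give a basis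
of the quotient. -/
theorem nonempty_basis_latticeQuotient (k : Type u) [CommRing k] (T : Type t) [LinearOrder T]
    [OrderBot T] [Finite T] (X : FinCorr.{w}) :
    Nonempty (Module.Basis (Fin (Nat.card {α : X → T // CoversNonBot α})) k
      ((latticeQuotient k T).eval X)) := by
  let p : ((X → T) →₀ k) →ₗ[k] {α : X → T // CoversNonBot α} →₀ k :=
    Finsupp.lsubtypeDomain {α : X → T | CoversNonBot α}
  have hp : Function.Surjective p := by
    intro v
    refine ⟨v.mapDomain Subtype.val, Finsupp.ext fun α => ?_⟩
    exact Finsupp.mapDomain_apply Subtype.val_injective v α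
  obtain ⟨i, -⟩ := exists_linearEquiv_of_ker_eq (latticeSub k T X).mkQ p
    (Submodule.mkQ_surjective _) hp ((Submodule.ker_mkQ _).trans (latticeSub_eq_ker k T X))
  exact ⟨Module.Basis.ofRepr (i.trans (Finsupp.domLCongr (Finite.equivFin _)))⟩

end CorrFun

theorem mainTheorem12 {k : Type u} [CommRing k] (n : ℕ) :
    Nonempty ((CorrFun.totalS k n : CorrFun.CorrespondenceFunctor.{u, w, max w u} k) ≅
      CorrFun.fundamentalFunctor k (CorrFun.totalOrder n)) ∧
    ∀ X : CorrFun.FinCorr.{w}, ∃ r : ℕ,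
      (r : ℤ) = ∑ i ∈ Finset.range (n + 1),
        (-1 : ℤ) ^ (n - i) * (n.choose i : ℤ) * ((i : ℤ) + 1) ^ Fintype.card X ∧
      Nonempty (Module.Basis (Fin r) k ((CorrFun.totalS k n).eval X)) := by
  constructor
  -- The value `n + 1 - e` runs from `n` at `e = 1` down to `1` at `e = n`, so `γ` is strictly
  -- decreasing and misses only `0`.
  · refine CorrFun.nonempty_latticeQuotient_iso_fundamentalFunctor
      (γ := fun e : Set.Icc 1 n => (⟨n + 1 - e, by have := e.2.1; omega⟩ : Fin (n + 1))) ?_ ?_ ?_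
    · rintro ⟨a, ha, ha'⟩ ⟨b, hb, hb'⟩ hab
      have hab : a < b := hab
      change n + 1 - b < n + 1 - a
      omega
    · rintro ⟨a, ha, ha'⟩ h
      have h0 : n + 1 - a = 0 := congrArg Fin.val h
      omega
    · intro a ha
      have ha' : (a : ℕ) ≠ 0 := fun h => ha (Fin.ext h)
      refine ⟨⟨n + 1 - (a : ℕ), ?_, ?_⟩, Fin.ext ?_⟩
      · have := a.2; omega
      · omega
      · dsimp only
        have := a.2; omega
  · intro X
    exact ⟨_, CorrFun.card_coversNonBot n X, CorrFun.nonempty_basis_latticeQuotient k _ X⟩
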